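/- All manifolds are smooth ($C^\infty$), without boundary, and modelled on real normed spaces of arbitrary (possibly infinite) dimension; $\Omega^k(M)$ denotes the complex vector space of smooth complex-valued $k$-forms on $M$, $d$ the exterior derivative, and $H^k_{dR}(M)$ the cohomology of the de Rham complex $(\Omega^\bullet(M),d)$. Let $\mathcal A$ be an affine space over a real normed space, with its standard manifold structure, let $B$ be a manifold, and let $\pi:\mathcal A\to B$ be a smooth locally trivial fibre bundle whose typical fibre is a manifold. For $k\ge 0$ put $$\Omega^k(\mathcal A\xrightarrow{\pi}B)=\Omega^k(\mathcal A)\,/\,\{\pi^*\omega:\ \omega\in\Omega^k(B)\},$$ and let $H^k_{dR}(\mathcal A\xrightarrow{\pi}B)$ be the cohomology in degree $k$ of the complex $\Omega^\bullet(\mathcal A\xrightarrow{\pi}B)$ with the differential induced by the exterior derivative $\hat d$ of $\mathcal A$ (the complex is $0$ in negative degrees). Then for every integer $k\ge 0$: 1. for every closed $F\in\Omega^{k+1}(B)$ there is $\hat\omega\in\Omega^k(\mathcal A)$ with $\hat d\hat\omega=\pi^*F$, and the class of any such $\hat\omega$ in $\Omega^k(\mathcal A\xrightarrow{\pi}B)$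 is a cocycle; 2. there is a $\mathbb C$-linear isomorphism $$H^{k+1}_{dR}(B)\;\xrightarrow{\ \cong\ }\;H^{k}_{dR}(\mathcal A\xrightarrow{\pi}B)$$ which sends $[F]$ to $[\hat\omega]$ whenever $F\in\Omega^{k+1}(B)$ is closed and $\hat\omega\in\Omega^k(\mathcal A)$ satisfies $\hat d\hat\omega=\pi^*F$. -/

import Mathlib

open scoped Manifold ContDiff Topology

noncomputable section

namespace DeRham

/-! ### Joint smoothness of the pullback of alternating maps by linear maps -/

section Alternating

variable {E E' G : Type*} [NormedAddCommGroup E] [NormedSpace ℝ E]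
  [NormedAddCommGroup E'] [NormedSpace ℝ E'] [NormedAddCommGroup G] [NormedSpace ℝ G]

/-- The continuous projection of multilinear maps onto alternating maps. -/
def altProj (k : ℕ) :
    ContinuousMultilinearMap ℝ (fun _ : Fin k => E) ℂ →L[ℝ] E [⋀^Fin k]→L[ℝ] ℂ :=
  LinearMap.mkContinuous
    { toFun := fun f => ((k.factorial : ℝ)⁻¹) • ContinuousMultilinearMap.alternatization f
      map_add' := fun f g => by rw [map_add, smul_add]
      map_smul' := fun c f => by
        ext v
        simp [ContinuousMultilinearMap.alternatization_apply_apply, Finset.smul_sum,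
          smul_comm c] }
    1 (fun f => by
      refine ContinuousAlternatingMap.opNorm_le_bound _ (by positivity) fun v => ?_
      have hk : (0 : ℝ) < k.factorial := by exact_mod_cast k.factorial_pos
      have h1 : ‖∑ σ : Equiv.Perm (Fin k), Equiv.Perm.sign σ • f (v ∘ σ)‖
          ≤ ∑ σ : Equiv.Perm (Fin k), ‖f‖ * ∏ i, ‖v i‖ := by
        refine norm_sum_le_of_le _ fun σ _ => ?_
        have h2 : ‖Equiv.Perm.sign σ • f (v ∘ σ)‖ = ‖f (v ∘ σ)‖ := by
          rcases Int.units_eq_one_or (Equiv.Perm.sign σ) with h | h <;> simp [h]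
        rw [h2]
        refine (f.le_opNorm _).trans (le_of_eq ?_)
        congr 1
        exact Equiv.prod_comp σ (fun i => ‖v i‖)
      have h3 : (∑ _σ : Equiv.Perm (Fin k), ‖f‖ * ∏ i, ‖v i‖)
          = k.factorial * (‖f‖ * ∏ i, ‖v i‖) := by
        simp [Fintype.card_perm]
      have h4 : (((k.factorial : ℝ)⁻¹) • ContinuousMultilinearMap.alternatization f) v
          = ((k.factorial : ℝ)⁻¹) • ∑ σ : Equiv.Perm (Fin k), Equiv.Perm.sign σ • f (v ∘ σ) := by
        rw [ContinuousAlternatingMap.smul_apply,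
          ContinuousMultilinearMap.alternatization_apply_apply]
      change ‖(((k.factorial : ℝ)⁻¹) • ContinuousMultilinearMap.alternatization f) v‖ ≤ _
      rw [h4, norm_smul, norm_inv, Real.norm_natCast, inv_mul_le_iff₀ hk, one_mul]
      exact h1.trans h3.le)

lemma altProj_toContinuousMultilinearMap {k : ℕ} (g : E [⋀^Fin k]→L[ℝ] ℂ) :
    altProj k g.toContinuousMultilinearMap = g := by
  ext v
  have hk : (k.factorial : ℝ) ≠ 0 := by exact_mod_cast k.factorial_ne_zero
  change (((k.factorial : ℝ)⁻¹) •
    ContinuousMultilinearMap.alternatization g.toContinuousMultilinearMap) v = g v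
  rw [ContinuousAlternatingMap.smul_apply, ContinuousMultilinearMap.alternatization_apply_apply]
  have h : ∀ σ : Equiv.Perm (Fin k),
      Equiv.Perm.sign σ • g.toContinuousMultilinearMap (v ∘ σ) = g v := fun σ => by
    have := g.toAlternatingMap.map_perm v σ
    change Equiv.Perm.sign σ • g.toAlternatingMap (v ∘ σ) = g.toAlternatingMap v
    rw [this, smul_smul, Int.units_mul_self, one_smul]
  rw [Finset.sum_congr rfl fun σ _ => h σ, Finset.sum_const, Finset.card_univ, Fintype.card_perm,
    Fintype.card_fin, ← Nat.cast_smul_eq_nsmul ℝ, smul_smul, inv_mul_cancel₀ hk, one_smul]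

lemma contDiffWithinAt_compContinuousLinearMap {k : ℕ} {n : WithTop ℕ∞}
    {α : G → E' [⋀^Fin k]→L[ℝ] ℂ} {L : G → E →L[ℝ] E'} {s : Set G} {x : G}
    (hα : ContDiffWithinAt ℝ n α s x) (hL : ContDiffWithinAt ℝ n L s x) :
    ContDiffWithinAt ℝ n (fun y => (α y).compContinuousLinearMap (L y)) s x := by
  have h0 : ContDiffWithinAt ℝ n (fun y => (α y).toContinuousMultilinearMap) s x :=
    (ContinuousAlternatingMap.toContinuousMultilinearMapCLM (𝕜 := ℝ) (R := ℝ) (E := E')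
      (F := ℂ) (ι := Fin k)).contDiff.comp_contDiffWithinAt hα
  have h1 : ContDiffWithinAt ℝ n
      (fun y => ((fun _ : Fin k => L y), (α y).toContinuousMultilinearMap)) s x :=
    (contDiffWithinAt_pi.2 fun _ => hL).prodMk h0
  have h2 := (ContinuousMultilinearMap.cpolynomialAt_uncurry_compContinuousLinearMap
    (𝕜 := ℝ) (Fm := fun _ : Fin k => E) (Em := fun _ : Fin k => E') (G := ℂ)
    (q := ((fun _ : Fin k => L x), (α x).toContinuousMultilinearMap))).analyticAt.contDiffAt
    (n := n)
  have h3 := (altProj (E := E) k).contDiff.comp_contDiffWithinAt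
    (h2.comp_contDiffWithinAt x h1)
  refine h3.congr (fun y _ => ?_) ?_
  · exact (altProj_toContinuousMultilinearMap ((α y).compContinuousLinearMap (L y))).symm
  · exact (altProj_toContinuousMultilinearMap ((α x).compContinuousLinearMap (L x))).symm

end Alternating

/-! ### Differential forms on manifolds -/

section Forms

variable {E E' E'' : Type*} [NormedAddCommGroup E] [NormedSpace ℝ E]
  [NormedAddCommGroup E'] [NormedSpace ℝ E'] [NormedAddCommGroup E''] [NormedSpace ℝ E'']
  {M N P : Type*} [TopologicalSpace M] [ChartedSpace E M] [TopologicalSpace N] [ChartedSpace E' N]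
  [TopologicalSpace P] [ChartedSpace E'' P]

/-- A complex-valued form of degree `k` on the manifold `M` (modelled on `E`), without any
regularity: a choice, for each `x`, of a continuous alternating `ℝ`-multilinear map
`(T_x M)^k → ℂ`. -/
abbrev RawForm (E : Type*) [NormedAddCommGroup E] [NormedSpace ℝ E] (M : Type*)
    [TopologicalSpace M] [ChartedSpace E M] (k : ℕ) : Type _ :=
  ∀ x : M, TangentSpace 𝓘(ℝ, E) x [⋀^Fin k]→L[ℝ] ℂ

/-- The pullback `(f^*α)_x (v₁, …, v_k) = α_{f x} (df_x v₁, …, df_x v_k)`. -/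
def pullRaw {k : ℕ} (f : M → N) (α : RawForm E' N k) : RawForm E M k :=
  fun x => (α (f x)).compContinuousLinearMap (mfderiv 𝓘(ℝ, E) 𝓘(ℝ, E') f x)

/-- The representation of a form in the preferred chart at `x₀`: its pullback by the inverse of
that chart (only meaningful on the target of the chart). -/
def chartRep {k : ℕ} (α : RawForm E M k) (x₀ : M) : E → E [⋀^Fin k]→L[ℝ] ℂ :=
  pullRaw (E := E) (E' := E) (M := E) (extChartAt 𝓘(ℝ, E) x₀).symm α

/-- A form is smooth if its representations in the charts are. -/
def IsSmoothForm {k : ℕ} (α : RawForm E M k) : Prop :=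
  ∀ x₀ : M, ContDiffOn ℝ ∞ (chartRep α x₀) (extChartAt 𝓘(ℝ, E) x₀).target

/-- The exterior derivative: in a chart it is the exterior derivative on the model space. -/
def extDerivRaw {k : ℕ} (α : RawForm E M k) : RawForm E M (k + 1) :=
  fun x => (extDeriv (chartRep α x) (extChartAt 𝓘(ℝ, E) x x)).compContinuousLinearMap
    (mfderiv 𝓘(ℝ, E) 𝓘(ℝ, E) (extChartAt 𝓘(ℝ, E) x) x)

lemma two_le_infty : (2 : WithTop ℕ∞) ≤ ∞ :=
  WithTop.coe_le_coe.2 (le_top : (2 : ℕ∞) ≤ ⊤)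

lemma pullRaw_comp_apply {k : ℕ} {f : M → N} {g : N → P} {x : M} (α : RawForm E'' P k)
    (hg : MDifferentiableAt 𝓘(ℝ, E') 𝓘(ℝ, E'') g (f x))
    (hf : MDifferentiableAt 𝓘(ℝ, E) 𝓘(ℝ, E') f x) :
    pullRaw (E := E) (g ∘ f) α x = pullRaw (E := E) f (pullRaw (E := E') g α) x := by
  ext v
  simp only [pullRaw, mfderiv_comp x hg hf]
  rfl

lemma pullRaw_congr {k : ℕ} {f g : M → N} {x : M} (α : RawForm E' N k) (h : f =ᶠ[𝓝 x] g) :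
    pullRaw (E := E) f α x = pullRaw (E := E) g α x := by
  have h2 := h.mfderiv_eq (I := 𝓘(ℝ, E)) (I' := 𝓘(ℝ, E'))
  have h1 : f x = g x := h.self_of_nhds
  unfold pullRaw
  ext v
  rw [h2]
  simp only [ContinuousAlternatingMap.compContinuousLinearMap_apply]
  generalize (mfderiv 𝓘(ℝ, E) 𝓘(ℝ, E') g x) = L
  revert L
  rw [← h1]
  intro L
  rfl

/-- The local formula for a pullback along a map defined on an open subset of a normed space. -/
lemma pullRaw_eventuallyEq [IsManifold 𝓘(ℝ, E') ∞ N] {k : ℕ} (α : RawForm E' N k) {f : E → N} {y : E}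
    (hf : ∀ᶠ z in 𝓝 y, ContMDiffAt 𝓘(ℝ, E) 𝓘(ℝ, E') ∞ f z) :
    (pullRaw (E := E) f α : E → E [⋀^Fin k]→L[ℝ] ℂ) =ᶠ[𝓝 y] fun z =>
      (chartRep α (f y) (extChartAt 𝓘(ℝ, E') (f y) (f z))).compContinuousLinearMap
        (fderiv ℝ (extChartAt 𝓘(ℝ, E') (f y) ∘ f) z) := by
  set φ := extChartAt 𝓘(ℝ, E') (f y) with hφ
  have hs : ∀ᶠ z in 𝓝 y, f z ∈ φ.source :=
    hf.self_of_nhds.continuousAt.eventually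
      ((isOpen_extChartAt_source (I := 𝓘(ℝ, E')) (f y)).mem_nhds (mem_extChartAt_source _))
  filter_upwards [hf, hs, hs.eventually_nhds] with z hz hzs hzs'
  have hzc : f z ∈ (chartAt E' (f y)).source := by
    rwa [hφ, extChartAt_source] at hzs
  have h1 : f =ᶠ[𝓝 z] φ.symm ∘ (φ ∘ f) := by
    filter_upwards [hzs'] with w hw
    exact (φ.left_inv hw).symm
  have hd : MDifferentiableAt 𝓘(ℝ, E) 𝓘(ℝ, E') (φ ∘ f) z :=
    (mdifferentiableAt_extChartAt hzc).comp z (hz.mdifferentiableAt (by simp))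
  have hsymm : MDifferentiableAt 𝓘(ℝ, E') 𝓘(ℝ, E') φ.symm ((φ ∘ f) z) :=
    (((contMDiffOn_extChartAt_symm (I := 𝓘(ℝ, E')) (n := ∞) (f y)).contMDiffAt
      ((isOpen_extChartAt_target (I := 𝓘(ℝ, E')) (f y)).mem_nhds
        (φ.map_source hzs))).mdifferentiableAt (by simp))
  have h2 := pullRaw_congr (E := E) α h1
  rw [pullRaw_comp_apply α hsymm hd] at h2
  refine h2.trans ?_
  rw [← mfderiv_eq_fderiv]
  rfl

lemma contDiffAt_chart_comp {f : E → N} {y : E} (hf : ContMDiffAt 𝓘(ℝ, E) 𝓘(ℝ, E') ∞ f y) :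
    ContDiffAt ℝ ∞ (extChartAt 𝓘(ℝ, E') (f y) ∘ f) y := by
  rw [← contMDiffAt_iff_contDiffAt]
  exact (contMDiffAt_extChartAt (I := 𝓘(ℝ, E')) (n := ∞) (x := f y)).comp y hf

lemma IsSmoothForm.contDiffAt_chartRep {k : ℕ} {α : RawForm E M k} (hα : IsSmoothForm α) (x : M)
    {y : E} (hy : y ∈ (extChartAt 𝓘(ℝ, E) x).target) :
    ContDiffAt ℝ ∞ (chartRep α x) y :=
  (hα x).contDiffAt ((isOpen_extChartAt_target x).mem_nhds hy)

/-- The pullback of a smooth form along a smooth map on an open subset of a normed space is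
smooth. -/
lemma IsSmoothForm.contDiffAt_pullRaw [IsManifold 𝓘(ℝ, E') ∞ N] {k : ℕ} {α : RawForm E' N k} (hα : IsSmoothForm α)
    {f : E → N} {y : E} (hf : ∀ᶠ z in 𝓝 y, ContMDiffAt 𝓘(ℝ, E) 𝓘(ℝ, E') ∞ f z) :
    ContDiffAt ℝ ∞ (F := E [⋀^Fin k]→L[ℝ] ℂ) (pullRaw (E := E) f α) y := by
  have hg := contDiffAt_chart_comp hf.self_of_nhds
  have h1 : ContDiffAt ℝ ∞ (fun z => chartRep α (f y) (extChartAt 𝓘(ℝ, E') (f y) (f z))) y :=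
    ContDiffAt.comp y (hα.contDiffAt_chartRep (f y) (mem_extChartAt_target (f y))) hg
  have h2 : ContDiffAt ℝ ∞ (fderiv ℝ (extChartAt 𝓘(ℝ, E') (f y) ∘ f)) y :=
    hg.fderiv_right (by simp)
  exact ContDiffAt.congr_of_eventuallyEq
    (contDiffWithinAt_compContinuousLinearMap (s := Set.univ) h1 h2) (pullRaw_eventuallyEq α hf)

/-- The exterior derivative commutes with pullback along a smooth map on an open subset of a
normed space. -/
lemma IsSmoothForm.extDeriv_pullRaw [IsManifold 𝓘(ℝ, E') ∞ N] {k : ℕ} {α : RawForm E' N k} (hα : IsSmoothForm α)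
    {f : E → N} {y : E} (hf : ∀ᶠ z in 𝓝 y, ContMDiffAt 𝓘(ℝ, E) 𝓘(ℝ, E') ∞ f z) :
    extDeriv (pullRaw (E := E) f α : E → E [⋀^Fin k]→L[ℝ] ℂ) y
      = pullRaw (E := E) f (extDerivRaw α) y := by
  have hg := contDiffAt_chart_comp hf.self_of_nhds
  have h1 := (hα.contDiffAt_chartRep (f y) (mem_extChartAt_target (f y))).differentiableAt
    (by simp)
  rw [(pullRaw_eventuallyEq α hf).extDeriv_eq]
  have h2 := extDeriv_pullback (f := extChartAt 𝓘(ℝ, E') (f y) ∘ f) (x := y) h1 hg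
    (by simpa using two_le_infty)
  refine h2.trans ?_
  have h3 := mfderiv_comp y (mdifferentiableAt_extChartAt (I := 𝓘(ℝ, E'))
    (mem_chart_source E' (f y))) (hf.self_of_nhds.mdifferentiableAt (by simp))
  rw [← mfderiv_eq_fderiv, h3]
  rfl

lemma eventually_contMDiffAt_symm [IsManifold 𝓘(ℝ, E) ∞ M] (x₀ : M) {y : E} (hy : y ∈ (extChartAt 𝓘(ℝ, E) x₀).target) :
    ∀ᶠ z in 𝓝 y, ContMDiffAt 𝓘(ℝ, E) 𝓘(ℝ, E) ∞ (extChartAt 𝓘(ℝ, E) x₀).symm z := by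
  have hopen := isOpen_extChartAt_target (I := 𝓘(ℝ, E)) x₀
  filter_upwards [hopen.mem_nhds hy] with z hz
  exact (contMDiffOn_extChartAt_symm x₀).contMDiffAt (hopen.mem_nhds hz)

/-- In any chart, the exterior derivative is the one of the model space. -/
lemma IsSmoothForm.chartRep_extDerivRaw [IsManifold 𝓘(ℝ, E) ∞ M] {k : ℕ} {α : RawForm E M k} (hα : IsSmoothForm α)
    (x₀ : M) {y : E} (hy : y ∈ (extChartAt 𝓘(ℝ, E) x₀).target) :
    chartRep (extDerivRaw α) x₀ y = extDeriv (chartRep α x₀) y :=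
  (hα.extDeriv_pullRaw (eventually_contMDiffAt_symm x₀ hy)).symm

lemma IsSmoothForm.extDerivRaw [IsManifold 𝓘(ℝ, E) ∞ M] {k : ℕ} {α : RawForm E M k} (hα : IsSmoothForm α) :
    IsSmoothForm (extDerivRaw α) := by
  intro x₀
  have h1 : ContDiffOn ℝ ∞ (extDeriv (chartRep α x₀)) (extChartAt 𝓘(ℝ, E) x₀).target := by
    intro y hy
    have h2 : ContDiffAt ℝ ∞ (fderiv ℝ (chartRep α x₀)) y :=
      (hα.contDiffAt_chartRep x₀ hy).fderiv_right (by simp)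
    exact ((ContinuousAlternatingMap.alternatizeUncurryFinCLM ℝ E ℂ).contDiff.contDiffAt.comp y
      h2).contDiffWithinAt
  exact h1.congr fun y hy => hα.chartRep_extDerivRaw x₀ hy

lemma IsSmoothForm.extDerivRaw_extDerivRaw [IsManifold 𝓘(ℝ, E) ∞ M] {k : ℕ} {α : RawForm E M k} (hα : IsSmoothForm α) :
    DeRham.extDerivRaw (DeRham.extDerivRaw α) = 0 := by
  funext x
  have hx := mem_extChartAt_target (I := 𝓘(ℝ, E)) x
  have h1 : chartRep (DeRham.extDerivRaw α) x
      =ᶠ[𝓝 (extChartAt 𝓘(ℝ, E) x x)] extDeriv (chartRep α x) := by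
    filter_upwards [(isOpen_extChartAt_target (I := 𝓘(ℝ, E)) x).mem_nhds hx] with y hy
    exact hα.chartRep_extDerivRaw x hy
  have h2 : extDeriv (chartRep (DeRham.extDerivRaw α) x) (extChartAt 𝓘(ℝ, E) x x) = 0 := by
    rw [h1.extDeriv_eq]
    exact extDeriv_extDeriv_apply (hα.contDiffAt_chartRep x hx) (by simpa using two_le_infty)
  rw [DeRham.extDerivRaw, h2]
  rfl

lemma chartRep_pullRaw [IsManifold 𝓘(ℝ, E) ∞ M] {k : ℕ} (α : RawForm E' N k) {f : M → N}
    (hf : ContMDiff 𝓘(ℝ, E) 𝓘(ℝ, E') ∞ f) (x₀ : M) {y : E}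
    (hy : y ∈ (extChartAt 𝓘(ℝ, E) x₀).target) :
    chartRep (pullRaw (E := E) f α) x₀ y
      = pullRaw (E := E) (f ∘ (extChartAt 𝓘(ℝ, E) x₀).symm) α y :=
  (pullRaw_comp_apply α (hf.contMDiffAt.mdifferentiableAt (by simp))
    ((eventually_contMDiffAt_symm x₀ hy).self_of_nhds.mdifferentiableAt (by simp))).symm

lemma IsSmoothForm.pullRaw [IsManifold 𝓘(ℝ, E) ∞ M] [IsManifold 𝓘(ℝ, E') ∞ N] {k : ℕ} {α : RawForm E' N k} (hα : IsSmoothForm α) {f : M → N}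
    (hf : ContMDiff 𝓘(ℝ, E) 𝓘(ℝ, E') ∞ f) : IsSmoothForm (pullRaw (E := E) f α) := by
  intro x₀
  refine ContDiffOn.congr (F := E [⋀^Fin k]→L[ℝ] ℂ)
    (f := DeRham.pullRaw (E := E) (f ∘ (extChartAt 𝓘(ℝ, E) x₀).symm) α) ?_
    fun y hy => chartRep_pullRaw α hf x₀ hy
  intro y hy
  refine (hα.contDiffAt_pullRaw ?_).contDiffWithinAt
  filter_upwards [eventually_contMDiffAt_symm x₀ hy] with z hz
  exact hf.contMDiffAt.comp z hz

/-- The exterior derivative commutes with pullback. -/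
lemma IsSmoothForm.extDerivRaw_pullRaw [IsManifold 𝓘(ℝ, E) ∞ M] [IsManifold 𝓘(ℝ, E') ∞ N] {k : ℕ} {α : RawForm E' N k} (hα : IsSmoothForm α)
    {f : M → N} (hf : ContMDiff 𝓘(ℝ, E) 𝓘(ℝ, E') ∞ f) :
    DeRham.extDerivRaw (DeRham.pullRaw (E := E) f α)
      = DeRham.pullRaw (E := E) f (DeRham.extDerivRaw α) := by
  funext x
  set φ := extChartAt 𝓘(ℝ, E) x with hφ
  have hx : φ x ∈ φ.target := mem_extChartAt_target (I := 𝓘(ℝ, E)) x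
  have hev := eventually_contMDiffAt_symm (E := E) x hx
  have h1 : chartRep (DeRham.pullRaw (E := E) f α) x
      =ᶠ[𝓝 (φ x)] DeRham.pullRaw (E := E) (f ∘ φ.symm) α := by
    filter_upwards [(isOpen_extChartAt_target (I := 𝓘(ℝ, E)) x).mem_nhds hx] with y hy
    exact chartRep_pullRaw α hf x hy
  have hsm : ∀ᶠ z in 𝓝 (φ x), ContMDiffAt 𝓘(ℝ, E) 𝓘(ℝ, E') ∞ (f ∘ φ.symm) z := by
    filter_upwards [hev] with z hz
    exact hf.contMDiffAt.comp z hz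
  have h2 : extDeriv (chartRep (DeRham.pullRaw (E := E) f α) x) (φ x)
      = DeRham.pullRaw (E := E) (f ∘ φ.symm) (DeRham.extDerivRaw α) (φ x) := by
    rw [h1.extDeriv_eq]
    exact hα.extDeriv_pullRaw hsm
  have hc : MDifferentiableAt 𝓘(ℝ, E) 𝓘(ℝ, E) φ x :=
    mdifferentiableAt_extChartAt (mem_chart_source E x)
  have h3 : f =ᶠ[𝓝 x] (f ∘ φ.symm) ∘ φ := by
    filter_upwards [(isOpen_extChartAt_source (I := 𝓘(ℝ, E)) x).mem_nhds
      (mem_extChartAt_source x)] with z hz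
    exact congrArg f (φ.left_inv hz).symm
  rw [pullRaw_congr _ h3,
    pullRaw_comp_apply _ (hsm.self_of_nhds.mdifferentiableAt (by simp)) hc]
  unfold DeRham.extDerivRaw
  rw [← hφ, h2]
  rfl

end Forms

/-! ### The de Rham complex -/

section Complex

variable {E E' : Type*} [NormedAddCommGroup E] [NormedSpace ℝ E]
  [NormedAddCommGroup E'] [NormedSpace ℝ E']
  {M N : Type*} [TopologicalSpace M] [ChartedSpace E M] [TopologicalSpace N] [ChartedSpace E' N]

lemma chartRep_add {k : ℕ} (α β : RawForm E M k) (x₀ : M) :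
    chartRep (α + β) x₀ = chartRep α x₀ + chartRep β x₀ := rfl

lemma chartRep_smul {k : ℕ} (c : ℂ) (α : RawForm E M k) (x₀ : M) :
    chartRep (c • α) x₀ = c • chartRep α x₀ := rfl

/-- The smooth forms form a complex subspace of all forms. -/
def smoothForms (E : Type*) [NormedAddCommGroup E] [NormedSpace ℝ E] (M : Type*)
    [TopologicalSpace M] [ChartedSpace E M] (k : ℕ) : Submodule ℂ (RawForm E M k) where
  carrier := {α | IsSmoothForm α}
  add_mem' := fun {α β} hα hβ x₀ => by
    rw [chartRep_add]; exact (hα x₀).add (hβ x₀)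
  zero_mem' := fun x₀ => contDiffOn_const (c := (0 : E [⋀^Fin k]→L[ℝ] ℂ))
  smul_mem' := fun c α hα x₀ => by
    rw [chartRep_smul]; exact (hα x₀).const_smul c

/-- `Ω^k(M, ℂ)`: the complex vector space of smooth complex-valued `k`-forms on `M`. -/
def Form (E : Type*) [NormedAddCommGroup E] [NormedSpace ℝ E] (M : Type*)
    [TopologicalSpace M] [ChartedSpace E M] (k : ℕ) : Type _ :=
  smoothForms E M k

instance (k : ℕ) : AddCommGroup (Form E M k) :=
  inferInstanceAs (AddCommGroup (smoothForms E M k))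

instance (k : ℕ) : Module ℂ (Form E M k) :=
  inferInstanceAs (Module ℂ (smoothForms E M k))

/-- The exterior derivative `d : Ω^k(M, ℂ) → Ω^{k+1}(M, ℂ)`. -/
def d (E : Type*) [NormedAddCommGroup E] [NormedSpace ℝ E] (M : Type*)
    [TopologicalSpace M] [ChartedSpace E M] [IsManifold 𝓘(ℝ, E) ∞ M] (k : ℕ) :
    Form E M k →ₗ[ℂ] Form E M (k + 1) where
  toFun α := ⟨extDerivRaw α.1, IsSmoothForm.extDerivRaw α.2⟩
  map_add' α β := by
    refine Subtype.ext (funext fun x => ?_)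
    have hα := (IsSmoothForm.contDiffAt_chartRep α.2 x (mem_extChartAt_target x)).differentiableAt
      (by simp)
    have hβ := (IsSmoothForm.contDiffAt_chartRep β.2 x (mem_extChartAt_target x)).differentiableAt
      (by simp)
    change extDerivRaw (α.1 + β.1) x = extDerivRaw α.1 x + extDerivRaw β.1 x
    unfold extDerivRaw
    rw [chartRep_add, extDeriv_add hα hβ]
    rfl
  map_smul' c α := by
    refine Subtype.ext (funext fun x => ?_)
    have hα := (IsSmoothForm.contDiffAt_chartRep α.2 x (mem_extChartAt_target x)).differentiableAt
      (by simp)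
    change extDerivRaw (c • α.1) x = c • extDerivRaw α.1 x
    have h : extDeriv (c • chartRep α.1 x) (extChartAt 𝓘(ℝ, E) x x)
        = c • extDeriv (chartRep α.1 x) (extChartAt 𝓘(ℝ, E) x x) := by
      unfold extDeriv
      rw [fderiv_const_smul hα, ContinuousAlternatingMap.alternatizeUncurryFin_smul]
    unfold extDerivRaw
    rw [chartRep_smul, h]
    rfl

lemma d_d [IsManifold 𝓘(ℝ, E) ∞ M] (k : ℕ) (α : Form E M k) : d E M (k + 1) (d E M k α) = 0 :=
  Subtype.ext (IsSmoothForm.extDerivRaw_extDerivRaw α.2)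

/-- The pullback `f^* : Ω^k(N, ℂ) → Ω^k(M, ℂ)` along a smooth map `f : M → N`. -/
def pullback [IsManifold 𝓘(ℝ, E) ∞ M] [IsManifold 𝓘(ℝ, E') ∞ N]
    (f : C^∞⟮𝓘(ℝ, E), M; 𝓘(ℝ, E'), N⟯) (k : ℕ) : Form E' N k →ₗ[ℂ] Form E M k where
  toFun α := ⟨pullRaw f α.1, IsSmoothForm.pullRaw α.2 f.contMDiff⟩
  map_add' _ _ := rfl
  map_smul' _ _ := rfl

lemma d_pullback [IsManifold 𝓘(ℝ, E) ∞ M] [IsManifold 𝓘(ℝ, E') ∞ N]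
    (f : C^∞⟮𝓘(ℝ, E), M; 𝓘(ℝ, E'), N⟯) (k : ℕ) (α : Form E' N k) :
    d E M k (pullback f k α) = pullback f (k + 1) (d E' N k α) :=
  Subtype.ext (IsSmoothForm.extDerivRaw_pullRaw α.2 f.contMDiff)

/-- `Ω^k(M → N, ℂ)`: smooth `k`-forms on `M` modulo the forms pulled back from `N`. -/
abbrev RelForm [IsManifold 𝓘(ℝ, E) ∞ M] [IsManifold 𝓘(ℝ, E') ∞ N]
    (f : C^∞⟮𝓘(ℝ, E), M; 𝓘(ℝ, E'), N⟯) (k : ℕ) : Type _ :=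
  Form E M k ⧸ LinearMap.range (pullback f k)

/-- The differential `Ω^k(M → N, ℂ) → Ω^{k+1}(M → N, ℂ)` induced by the exterior derivative. -/
def relD [IsManifold 𝓘(ℝ, E) ∞ M] [IsManifold 𝓘(ℝ, E') ∞ N]
    (f : C^∞⟮𝓘(ℝ, E), M; 𝓘(ℝ, E'), N⟯) (k : ℕ) : RelForm f k →ₗ[ℂ] RelForm f (k + 1) :=
  Submodule.mapQ _ _ (d E M k) (by
    rintro _ ⟨α, rfl⟩
    exact ⟨d E' N k α, (d_pullback f k α).symm⟩)

end Complex

/-! ### Cohomology -/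

section Cohomology

variable {C : ℕ → Type*} [∀ k, AddCommGroup (C k)] [∀ k, Module ℂ (C k)]

/-- The coboundaries in degree `k` of a complex `C 0 → C 1 → C 2 → ⋯` (which is `0` in negative
degrees). -/
def coboundaries (δ : ∀ k, C k →ₗ[ℂ] C (k + 1)) : ∀ k, Submodule ℂ (C k)
  | 0 => ⊥
  | k + 1 => LinearMap.range (δ k)

/-- The cohomology in degree `k` of a complex `C 0 → C 1 → C 2 → ⋯`: cocycles modulo
coboundaries. -/
abbrev Cohomology (δ : ∀ k, C k →ₗ[ℂ] C (k + 1)) (k : ℕ) : Type _ :=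
  LinearMap.ker (δ k) ⧸ (coboundaries δ k).comap (LinearMap.ker (δ k)).subtype

/-- The cohomology class of a cocycle. -/
def cohomologyClass (δ : ∀ k, C k →ₗ[ℂ] C (k + 1)) (k : ℕ) (c : C k) (hc : δ k c = 0) :
    Cohomology δ k :=
  Submodule.Quotient.mk ⟨c, hc⟩

end Cohomology

section DeRhamCohomology

variable {E E' : Type*} [NormedAddCommGroup E] [NormedSpace ℝ E]
  [NormedAddCommGroup E'] [NormedSpace ℝ E']
  {M N : Type*} [TopologicalSpace M] [ChartedSpace E M] [TopologicalSpace N] [ChartedSpace E' N]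

/-- `H^k_{dR}(M, ℂ)`. -/
abbrev HdR (E : Type*) [NormedAddCommGroup E] [NormedSpace ℝ E] (M : Type*)
    [TopologicalSpace M] [ChartedSpace E M] [IsManifold 𝓘(ℝ, E) ∞ M] (k : ℕ) : Type _ :=
  Cohomology (C := fun k => Form E M k) (d E M) k

/-- `H^k_{dR}(M → N, ℂ)`. -/
abbrev RelHdR [IsManifold 𝓘(ℝ, E) ∞ M] [IsManifold 𝓘(ℝ, E') ∞ N]
    (f : C^∞⟮𝓘(ℝ, E), M; 𝓘(ℝ, E'), N⟯) (k : ℕ) : Type _ :=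
  Cohomology (C := RelForm f) (relD f) k

/-- The class `[F] ∈ H^k_{dR}(M, ℂ)` of a closed form. -/
def HdR.mk [IsManifold 𝓘(ℝ, E) ∞ M] {k : ℕ} (F : Form E M k) (hF : d E M k F = 0) : HdR E M k :=
  cohomologyClass (C := fun k => Form E M k) (d E M) k F hF

/-- The class in `H^k_{dR}(M → N, ℂ)` of a form on `M` whose image in `Ω^k(M → N, ℂ)` is a
cocycle. -/
def RelHdR.mk [IsManifold 𝓘(ℝ, E) ∞ M] [IsManifold 𝓘(ℝ, E') ∞ N]
    (f : C^∞⟮𝓘(ℝ, E), M; 𝓘(ℝ, E'), N⟯) {k : ℕ} (α : Form E M k)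
    (hα : relD f k (Submodule.Quotient.mk α) = 0) : RelHdR f k :=
  cohomologyClass (C := RelForm f) (relD f) k (Submodule.Quotient.mk α) hα

/-- If `dα = f^*F`, then the image of `α` in `Ω^k(M → N, ℂ)` is a cocycle. -/
lemma relD_mk_eq_zero [IsManifold 𝓘(ℝ, E) ∞ M] [IsManifold 𝓘(ℝ, E') ∞ N]
    (f : C^∞⟮𝓘(ℝ, E), M; 𝓘(ℝ, E'), N⟯) {k : ℕ} {α : Form E M k} {F : Form E' N (k + 1)}
    (h : d E M k α = pullback f (k + 1) F) : relD f k (Submodule.Quotient.mk α) = 0 :=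
  (Submodule.Quotient.mk_eq_zero _).2 ⟨F, h.symm⟩

end DeRhamCohomology

/-! ### Fibre bundles and affine spaces -/

/-- `π : A → B` is a smooth (locally trivial) fibre bundle with typical fibre `F`, where `A`, `B`,
`F` are modelled on `E`, `E'`, `E''`: around each
point of `B` there is a local trivialization which is a diffeomorphism. -/
def IsSmoothFibreBundle (E E' E'' : Type*) [NormedAddCommGroup E] [NormedSpace ℝ E]
    [NormedAddCommGroup E'] [NormedSpace ℝ E'] [NormedAddCommGroup E''] [NormedSpace ℝ E'']
    {A B : Type*} [TopologicalSpace A] [ChartedSpace E A] [TopologicalSpace B] [ChartedSpace E' B]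
    (F : Type*) [TopologicalSpace F] [ChartedSpace E'' F] (π : A → B) : Prop :=
  ∀ b : B, ∃ e : Bundle.Trivialization F π, b ∈ e.baseSet ∧
    ContMDiffOn 𝓘(ℝ, E) (𝓘(ℝ, E').prod 𝓘(ℝ, E'')) ∞ e e.source ∧
    ContMDiffOn (𝓘(ℝ, E').prod 𝓘(ℝ, E'')) 𝓘(ℝ, E) ∞ e.toOpenPartialHomeomorph.symm e.target

/-- The manifold structure of the affine space `A` over the normed space `V` is the standard one:
the bijections `v ↦ v +ᵥ p` are diffeomorphisms from `V` onto `A`. -/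
def IsStandardAffineManifold (V A : Type*) [NormedAddCommGroup V] [NormedSpace ℝ V]
    [MetricSpace A] [NormedAddTorsor V A] [ChartedSpace V A] : Prop :=
  ∀ p : A, ContMDiff 𝓘(ℝ, V) 𝓘(ℝ, V) ∞ (fun v : V => v +ᵥ p) ∧
    ContMDiff 𝓘(ℝ, V) 𝓘(ℝ, V) ∞ (fun q : A => q -ᵥ p)

end DeRham

end

/-! By definition of the relative forms, `0 → Ω(B) → Ω(A) → Ω(A → B) → 0` is exact as soon as `π^*`
is injective, and the isomorphism is the inverse of its connecting homomorphism. Three facts are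
needed.

Closed forms of positive degree on `A` are exact (`IsStandardAffineManifold.exists_d_eq`). After a
choice of origin this is the Poincaré lemma on a normed space, with primitive `η(x) = ∫₀¹ t^k ι_x
α(tx) dt`. The integral is taken in a space of `ℂ`-valued alternating maps, which is complete even
if `V` is not, and compactness is used only for `[0, 1]`, so the dimension plays no role.

Closed `0`-forms on `A` are constants, hence pulled back from `B`. Thus `H⁰(A)`, although nonzero,
dies in the relative complex, and degree `k = 0` is no exception.

The map `π^*` is injective (`IsSmoothFibreBundle.pullback_injective`), because `π` has smooth local
sections around every point of `B`.

`exists_linearEquiv_relHdR` is the diagram chase that combines them. -/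

namespace DeRham

/-! ### Parameter integrals and the radial homotopy operator on a normed space. -/

section Poincare

universe u

variable {V G : Type*} [NormedAddCommGroup V] [NormedSpace ℝ V]
  [NormedAddCommGroup G] [NormedSpace ℝ G]

open MeasureTheory in
/-- Differentiation under the integral sign over `[0, 1]` for a `C^1` integrand. -/
lemma hasFDerivAt_integral_of_contDiff [CompleteSpace G] {f : V × ℝ → G} (hf : ContDiff ℝ 1 f)
    (x₀ : V) :
    HasFDerivAt (fun x => ∫ t in (0 : ℝ)..1, f (x, t))
      (∫ t in (0 : ℝ)..1, (fderiv ℝ f (x₀, t)).comp (ContinuousLinearMap.inl ℝ V ℝ)) x₀ := by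
  set F' : V × ℝ → V →L[ℝ] G :=
    fun p => (fderiv ℝ f p).comp (ContinuousLinearMap.inl ℝ V ℝ) with hF'
  have hF'c : Continuous F' := (hf.continuous_fderiv one_ne_zero).clm_comp continuous_const
  have hc : Continuous fun t : ℝ => F' (x₀, t) := hF'c.comp (by fun_prop)
  obtain ⟨C, hC⟩ := (isCompact_Icc (a := (0 : ℝ)) (b := 1)).exists_bound_of_continuousOn
    hc.continuousOn
  -- `V` need not be locally compact, so the derivative is bounded on the slice `{x₀} × [0, 1]`
  -- only; the tube lemma extends this to nearby `x`, and the slack `C + 1` makes the inequality an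
  -- open condition.
  have hs : ∀ᶠ x in 𝓝 x₀, ∀ t ∈ Set.Icc (0 : ℝ) 1, ‖F' (x, t)‖ < C + 1 := by
    refine isCompact_Icc.eventually_forall_of_forall_eventually fun t ht => ?_
    exact hF'c.norm.continuousAt.eventually_lt continuousAt_const
      ((hC t ht).trans_lt (lt_add_one C))
  refine intervalIntegral.hasFDerivAt_integral_of_dominated_of_fderiv_le (μ := volume)
    (F := fun x t => f (x, t)) (F' := fun x t => F' (x, t)) (bound := fun _ => C + 1) hs
    ?_ ?_ ?_ ?_ ?_ ?_
  · exact Filter.Eventually.of_forall fun x =>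
      (hf.continuous.comp (by fun_prop : Continuous fun t : ℝ => (x, t))).aestronglyMeasurable
  · exact (hf.continuous.comp
      (by fun_prop : Continuous fun t : ℝ => (x₀, t))).intervalIntegrable _ _
  · exact hc.aestronglyMeasurable
  · refine Filter.Eventually.of_forall fun t ht x hx => (hx t ?_).le
    rw [Set.uIoc_of_le zero_le_one] at ht
    exact Set.Ioc_subset_Icc_self ht
  · exact intervalIntegrable_const
  · refine Filter.Eventually.of_forall fun t _ x _ => ?_
    have h1 := (hf.differentiable one_ne_zero (x, t)).hasFDerivAt
    exact h1.comp x (hasFDerivAt_prodMk_left x t)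

/-- The derivative of the integral is again such an integral, now with values in `V →L[ℝ] G`. Hence
the induction must let `G` vary, and the common universe of `V` and `G` keeps this new target within
its range. -/
lemma contDiff_nat_integral (n : ℕ) : ∀ {V G : Type u} [NormedAddCommGroup V] [NormedSpace ℝ V]
    [NormedAddCommGroup G] [NormedSpace ℝ G] [CompleteSpace G] {f : V × ℝ → G},
    ContDiff ℝ ∞ f → ContDiff ℝ n (fun x => ∫ t in (0 : ℝ)..1, f (x, t)) := by
  induction n with
  | zero =>
    intro V G _ _ _ _ _ f hf
    exact contDiff_zero.2 (continuous_iff_continuousAt.2 fun x =>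
      (hasFDerivAt_integral_of_contDiff (hf.of_le (by simp)) x).continuousAt)
  | succ n ih =>
    intro V G _ _ _ _ _ f hf
    have h := hasFDerivAt_integral_of_contDiff (hf.of_le (by simp))
    push_cast
    refine contDiff_succ_iff_fderiv.2 ⟨fun x => (h x).differentiableAt, by simp, ?_⟩
    rw [funext fun x => (h x).fderiv]
    exact ih (f := fun p => (fderiv ℝ f p).comp (ContinuousLinearMap.inl ℝ V ℝ))
      ((hf.fderiv_right (by simp)).clm_comp contDiff_const)

lemma contDiff_infty_integral {V G : Type u} [NormedAddCommGroup V] [NormedSpace ℝ V]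
    [NormedAddCommGroup G] [NormedSpace ℝ G] [CompleteSpace G] {f : V × ℝ → G}
    (hf : ContDiff ℝ ∞ f) : ContDiff ℝ ∞ (fun x => ∫ t in (0 : ℝ)..1, f (x, t)) :=
  contDiff_infty.2 fun n => contDiff_nat_integral n hf

open ContinuousAlternatingMap in
/-- Cartan's formula for the radial vector field, along the dilation by `t`. -/
lemma alternatize_curryLeft_eq_of_extDeriv_eq_zero {k : ℕ} (w : V [⋀^Fin (k + 1)]→L[ℝ] G)
    (D : V →L[ℝ] V [⋀^Fin (k + 1)]→L[ℝ] G) (hD : alternatizeUncurryFin D = 0) (x : V) (t : ℝ)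
    (L : V →L[ℝ] V [⋀^Fin k]→L[ℝ] G)
    (hL : ∀ v, L v = t ^ k • (t • (D v).curryLeft x + w.curryLeft v)) :
    alternatizeUncurryFin L = ((k + 1 : ℕ) * t ^ k) • w + t ^ (k + 1) • D x := by
  ext v
  -- Closedness is evaluated on the tuple `(x, v₀, …, v_k)`; its term of index `0` is `D x v`, and
  -- the others contain `x` in first place.
  have h1 := congrArg (fun g => g (Fin.cons x v : Fin (k + 2) → V)) hD
  have h2 := congrArg (fun g => g v) (alternatizeUncurryFin_curryLeft w)
  simp only [alternatizeUncurryFin_apply] at h1 h2 ⊢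
  rw [Fin.sum_univ_succ] at h1
  have h3 : ∀ i : Fin (k + 1), (i.succ.removeNth (Fin.cons x v : Fin (k + 2) → V))
      = (Fin.cons x (i.removeNth v) : Fin (k + 1) → V) := fun i => by
    ext j
    refine Fin.cases ?_ (fun j => ?_) j <;> simp [Fin.removeNth]
  simp only [h3] at h1
  -- Moving `x` to the front shifts every index by one, which reverses the signs: the remaining
  -- terms add up to `D x v`.
  have h4 : ∑ i : Fin (k + 1), (-1 : ℤ) ^ (i : ℕ) • D (v i) (Fin.cons x (i.removeNth v)) = D x v := by
    rw [eq_comm, ← add_neg_eq_zero]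
    refine Eq.trans ?_ h1
    simp [pow_succ]
  have h5 : ∀ i : Fin (k + 1), (-1 : ℤ) ^ (i : ℕ) • L (v i) (i.removeNth v)
      = t ^ (k + 1) • ((-1 : ℤ) ^ (i : ℕ) • D (v i) (Fin.cons x (i.removeNth v)))
        + t ^ k • ((-1 : ℤ) ^ (i : ℕ) • w.curryLeft (v i) (i.removeNth v)) := fun i => by
    rw [hL, smul_comm (t ^ (k + 1)), smul_comm (t ^ k), ← smul_add, pow_succ, mul_smul, ← smul_add]
    rfl
  rw [Finset.sum_congr rfl fun i _ => h5 i, Finset.sum_add_distrib, ← Finset.smul_sum,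
    ← Finset.smul_sum, h4, h2, add_comm]
  simp [← Nat.cast_smul_eq_nsmul ℝ, smul_smul, mul_comm]

/-- The fundamental theorem of calculus for the derivative of a parameter integral. -/
lemma map_fderiv_integral_eq_sub [CompleteSpace G] {H : Type*} [NormedAddCommGroup H]
    [NormedSpace ℝ H] [CompleteSpace H] {f : V × ℝ → G} (hf : ContDiff ℝ 1 f) (x : V)
    (T : (V →L[ℝ] G) →L[ℝ] H) {g : ℝ → H}
    (hg : ∀ t, HasDerivAt g (T (fderiv ℝ (fun y => f (y, t)) x)) t) :
    T (fderiv ℝ (fun y => ∫ t in (0 : ℝ)..1, f (y, t)) x) = g 1 - g 0 := by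
  have h1 : ∀ t, fderiv ℝ (fun y => f (y, t)) x
      = (fderiv ℝ f (x, t)).comp (ContinuousLinearMap.inl ℝ V ℝ) := fun t =>
    ((hf.differentiable one_ne_zero (x, t)).hasFDerivAt.comp x (hasFDerivAt_prodMk_left x t)).fderiv
  have hc : Continuous fun t : ℝ =>
      (fderiv ℝ f (x, t)).comp (ContinuousLinearMap.inl ℝ V ℝ) :=
    ((hf.continuous_fderiv one_ne_zero).comp
      (by fun_prop : Continuous fun t : ℝ => (x, t))).clm_comp continuous_const
  simp only [h1] at hg
  rw [(hasFDerivAt_integral_of_contDiff hf x).fderiv,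
    ← ContinuousLinearMap.intervalIntegral_comp_comm _ (hc.intervalIntegrable _ _),
    intervalIntegral.integral_eq_sub_of_hasDerivAt (fun t _ => hg t)
      ((T.continuous.comp hc).intervalIntegrable _ _)]

/-- Product rule for the homotopy integrand: `c` stands for the interior product, `s` for `t ^ k`,
and the inner factor `t` comes from the dilation `y ↦ t • y`. -/
lemma fderiv_smul_clm_comp_smul {W : Type*} [NormedAddCommGroup W] [NormedSpace ℝ W]
    (c : W →L[ℝ] V →L[ℝ] G) {β : V → W} (s t : ℝ) {x : V} (hβ : DifferentiableAt ℝ β (t • x))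
    (v : V) :
    fderiv ℝ (fun y => s • c (β (t • y)) y) x v
      = s • (t • c (fderiv ℝ β (t • x) v) x + c (β (t • x)) v) := by
  have h2 : HasFDerivAt (fun y : V => β (t • y))
      ((fderiv ℝ β (t • x)).comp (t • ContinuousLinearMap.id ℝ V)) x :=
    hβ.hasFDerivAt.comp x ((hasFDerivAt_id x).const_smul t)
  have h3 := ((c.hasFDerivAt.comp x h2).clm_apply (hasFDerivAt_id x)).const_smul s
  have h4 : fderiv ℝ (fun y => s • c (β (t • y)) y) x = _ := h3.fderiv
  rw [h4]
  simp [add_comm]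

/-- The Poincaré lemma on a normed space. -/
lemma exists_extDeriv_eq {V : Type*} [NormedAddCommGroup V] [NormedSpace ℝ V] {k : ℕ}
    {α : V → V [⋀^Fin (k + 1)]→L[ℝ] ℂ} (hα : ContDiff ℝ ∞ α) (hd : ∀ x, extDeriv α x = 0) :
    ∃ η : V → V [⋀^Fin k]→L[ℝ] ℂ, ContDiff ℝ ∞ η ∧ ∀ x, extDeriv η x = α x := by
  set c := (ContinuousAlternatingMap.curryLeftLI (𝕜 := ℝ) (E := V) (F := ℂ)
    (n := k)).toContinuousLinearMap with hc
  -- The integrand is `t^k ι_x α(tx)`.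
  set f : V × ℝ → V [⋀^Fin k]→L[ℝ] ℂ := fun p => p.2 ^ k • c (α (p.2 • p.1)) p.1 with hf
  have hfs : ContDiff ℝ ∞ f :=
    (contDiff_snd.pow k).smul
      ((c.contDiff.comp (hα.comp (contDiff_snd.smul contDiff_fst))).clm_apply contDiff_fst)
  refine ⟨fun x => ∫ t in (0 : ℝ)..1, f (x, t), contDiff_infty_integral hfs, fun x => ?_⟩
  have hα1 : ∀ y, HasFDerivAt α (fderiv ℝ α y) y := fun y =>
    (hα.differentiable (by simp) y).hasFDerivAt
  have hfd : ∀ t v, fderiv ℝ (fun y => f (y, t)) x v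
      = t ^ k • (t • (fderiv ℝ α (t • x) v).curryLeft x + (α (t • x)).curryLeft v) :=
    fun t v => fderiv_smul_clm_comp_smul c (t ^ k) t (hα1 (t • x)).differentiableAt v
  -- By Cartan's formula, `d` of the integrand at time `t` is the `t`-derivative of `t^(k+1) α(tx)`,
  -- which is the pullback of `α` by the dilation.
  have hder : ∀ t : ℝ, HasDerivAt (fun t : ℝ => t ^ (k + 1) • α (t • x))
      (ContinuousAlternatingMap.alternatizeUncurryFinCLM ℝ V ℂ
        (fderiv ℝ (fun y => f (y, t)) x)) t := by
    intro t
    have h1 : HasDerivAt (fun t : ℝ => α (t • x)) (fderiv ℝ α (t • x) x) t := by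
      have h0 : HasDerivAt (fun t : ℝ => t • x) x t := by
        simpa using (hasDerivAt_id t).smul_const x
      exact (hα1 (t • x)).comp_hasDerivAt t h0
    have h2 := (hasDerivAt_pow (k + 1) t).smul h1
    rw [ContinuousAlternatingMap.alternatizeUncurryFinCLM_apply,
      alternatize_curryLeft_eq_of_extDeriv_eq_zero (α (t • x)) (fderiv ℝ α (t • x))
        (hd (t • x)) x t (fderiv ℝ (fun y => f (y, t)) x) (hfd t)]
    exact h2.congr_deriv (add_comm _ _)
  have h := map_fderiv_integral_eq_sub (hfs.of_le (by simp)) x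
    (ContinuousAlternatingMap.alternatizeUncurryFinCLM ℝ V ℂ) hder
  refine h.trans ?_
  -- The boundary term is `α x` at `t = 1` and vanishes at `t = 0` because the exponent `k + 1` is
  -- positive.
  simp

end Poincare

/-! ### Forms on a normed space as forms on a manifold with the identity chart. -/

section NormedSpaceForms

variable {V : Type*} [NormedAddCommGroup V] [NormedSpace ℝ V] {k : ℕ}

lemma chartRep_self (α : V → V [⋀^Fin k]→L[ℝ] ℂ) (x₀ : V) :
    chartRep (E := V) (M := V) α x₀ = α := by
  funext x
  have h : ((extChartAt 𝓘(ℝ, V) x₀).symm : V → V) = id := rfl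
  have h1 : chartRep (E := V) (M := V) α x₀ x = pullRaw (E := V) (E' := V) (N := V) id α x := by
    unfold chartRep
    rw [h]
  rw [h1]
  ext v
  simp only [pullRaw, mfderiv_id]
  rfl

lemma isSmoothForm_self_iff {α : V → V [⋀^Fin k]→L[ℝ] ℂ} :
    IsSmoothForm (E := V) (M := V) α ↔ ContDiff ℝ ∞ α := by
  have h : ∀ x : V, (extChartAt 𝓘(ℝ, V) x).target = Set.univ := fun x => by
    change ((OpenPartialHomeomorph.refl V).extend 𝓘(ℝ, V)).target = Set.univ
    simp only [mfld_simps]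
  simp only [IsSmoothForm, chartRep_self, h, contDiffOn_univ, forall_const]

lemma extDerivRaw_self (α : V → V [⋀^Fin k]→L[ℝ] ℂ) (x : V) :
    extDerivRaw (E := V) (M := V) α x = extDeriv α x := by
  unfold extDerivRaw
  rw [chartRep_self]
  have h : (extChartAt 𝓘(ℝ, V) x : V → V) = id := rfl
  rw [h]
  ext v
  simp only [mfderiv_id]
  rfl

/-- The Poincaré lemma for forms on a normed space, seen as a manifold. -/
lemma exists_d_eq_of_normedSpace (α : Form V V (k + 1)) (hα : d V V (k + 1) α = 0) :
    ∃ η : Form V V k, d V V k η = α := by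
  obtain ⟨η, hη, hd⟩ := exists_extDeriv_eq (isSmoothForm_self_iff.1 α.2) fun x =>
    (extDerivRaw_self α.1 x).symm.trans (congrFun (congrArg Subtype.val hα) x)
  exact ⟨⟨η, isSmoothForm_self_iff.2 hη⟩,
    Subtype.ext (funext fun x => (extDerivRaw_self η x).trans (hd x))⟩

/-- On a `0`-form the exterior derivative evaluated at one vector `u` is the ordinary derivative in
direction `u`, so its vanishing kills `fderiv`. -/
lemma eq_of_extDeriv_eq_zero {f : V → V [⋀^Fin 0]→L[ℝ] ℂ} (hf : Differentiable ℝ f)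
    (h : ∀ x, extDeriv f x = 0) (x y : V) : f x = f y := by
  refine is_const_of_fderiv_eq_zero hf (fun z => ?_) x y
  ext u v
  have h1 := congrArg (fun g => g fun _ : Fin 1 => u) (h z)
  simp only [extDeriv, ContinuousAlternatingMap.alternatizeUncurryFin_apply] at h1
  rw [Subsingleton.elim v (Fin.removeNth (0 : Fin 1) fun _ => u)]
  simpa using h1

end NormedSpaceForms

/-! ### Pullbacks along maps with one-sided inverses, and injectivity of `π^*`. -/

section Pullback

variable {E E' E'' : Type*} [NormedAddCommGroup E] [NormedSpace ℝ E]
  [NormedAddCommGroup E'] [NormedSpace ℝ E'] [NormedAddCommGroup E''] [NormedSpace ℝ E'']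
  {M N : Type*} [TopologicalSpace M] [ChartedSpace E M] [TopologicalSpace N] [ChartedSpace E' N]

lemma pullRaw_id {k : ℕ} (α : RawForm E M k) (x : M) : pullRaw (E := E) id α x = α x := by
  ext v
  simp only [pullRaw, mfderiv_id]
  rfl

/-- A form can be recovered at `x` from its pullback along `g` if `g` has a right inverse `f`
near `x`. -/
lemma pullRaw_pullRaw_eq_self {k : ℕ} {f : M → N} {g : N → M} {x : M} (α : RawForm E M k)
    (hg : MDifferentiableAt 𝓘(ℝ, E') 𝓘(ℝ, E) g (f x))
    (hf : MDifferentiableAt 𝓘(ℝ, E) 𝓘(ℝ, E') f x) (h : g ∘ f =ᶠ[𝓝 x] id) :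
    pullRaw (E := E) f (pullRaw (E := E') g α) x = α x := by
  rw [← pullRaw_comp_apply α hg hf, pullRaw_congr α h, pullRaw_id]

lemma pullback_pullback_eq_self [IsManifold 𝓘(ℝ, E) ∞ M] [IsManifold 𝓘(ℝ, E') ∞ N] {k : ℕ}
    (f : C^∞⟮𝓘(ℝ, E), M; 𝓘(ℝ, E'), N⟯) (g : C^∞⟮𝓘(ℝ, E'), N; 𝓘(ℝ, E), M⟯)
    (h : ∀ x, g (f x) = x) (α : Form E M k) : pullback f k (pullback g k α) = α :=
  Subtype.ext (funext fun x => pullRaw_pullRaw_eq_self α.1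
    (g.contMDiff.mdifferentiableAt (by simp)) (f.contMDiff.mdifferentiableAt (by simp))
    (Filter.Eventually.of_forall h))

/-- The constant function `c` as a form of degree `0`. -/
noncomputable def constForm (E : Type*) [NormedAddCommGroup E] [NormedSpace ℝ E] (M : Type*)
    [TopologicalSpace M] [ChartedSpace E M] (c : ℂ) : Form E M 0 :=
  ⟨fun _ => ContinuousAlternatingMap.constOfIsEmpty ℝ _ (Fin 0) c, fun _ =>
    contDiffOn_const (c := ContinuousAlternatingMap.constOfIsEmpty ℝ E (Fin 0) c)⟩

/-- Pullback along the projection of a smooth fibre bundle with nonempty total space is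
injective. -/
lemma IsSmoothFibreBundle.pullback_injective [IsManifold 𝓘(ℝ, E) ∞ M] [IsManifold 𝓘(ℝ, E') ∞ N]
    [Nonempty M] {F : Type*} [TopologicalSpace F] [ChartedSpace E'' F]
    {π : C^∞⟮𝓘(ℝ, E), M; 𝓘(ℝ, E'), N⟯} (hπ : IsSmoothFibreBundle E E' E'' F π) (k : ℕ) :
    Function.Injective (pullback π k) := by
  rw [injective_iff_map_eq_zero]
  intro α hα
  refine Subtype.ext (funext fun b => ?_)
  -- One point of the total space gives a point of the typical fibre, hence points over every `b`.
  obtain ⟨y⟩ : Nonempty F := by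
    obtain ⟨a⟩ := ‹Nonempty M›
    obtain ⟨e, -, -⟩ := hπ (π a)
    exact ⟨(e a).2⟩
  obtain ⟨e, hb, -, he⟩ := hπ b
  have hmem : ∀ b' ∈ e.baseSet, (b', y) ∈ e.target := fun b' hb' => e.mem_target.2 hb'
  -- The local section that is constant, equal to `y`, in the trivialization.
  set s : N → M := fun b' => e.toOpenPartialHomeomorph.symm (b', y) with hs
  have hsb : MDifferentiableAt 𝓘(ℝ, E') 𝓘(ℝ, E) s b := by
    have h1 := (he.contMDiffAt (e.open_target.mem_nhds (hmem b hb))).mdifferentiableAt (by simp)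
    exact h1.comp b (mdifferentiableAt_id.prodMk mdifferentiableAt_const)
  have hπs : π ∘ s =ᶠ[𝓝 b] id := by
    filter_upwards [e.open_baseSet.mem_nhds hb] with b' hb'
    exact e.proj_symm_apply (hmem b' hb')
  have h := pullRaw_pullRaw_eq_self α.1 (π.contMDiff.mdifferentiableAt (by simp)) hsb hπs
  rw [← h]
  have h0 : pullRaw (E := E) π α.1 = 0 := congrArg Subtype.val hα
  rw [h0]
  rfl

end Pullback

/-! ### Transfer of the Poincaré lemma to an affine space. -/

section Affine

variable {V A : Type*} [NormedAddCommGroup V] [NormedSpace ℝ V] [MetricSpace A]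
  [NormedAddTorsor V A] [ChartedSpace V A]

/-- The parametrization of an affine space by the translations of a point. -/
def IsStandardAffineManifold.param (hA : IsStandardAffineManifold V A) (p : A) :
    C^∞⟮𝓘(ℝ, V), V; 𝓘(ℝ, V), A⟯ :=
  ⟨fun v => v +ᵥ p, (hA p).1⟩

/-- The coordinate of an affine space with a chosen origin. -/
def IsStandardAffineManifold.coord (hA : IsStandardAffineManifold V A) (p : A) :
    C^∞⟮𝓘(ℝ, V), A; 𝓘(ℝ, V), V⟯ :=
  ⟨fun q => q -ᵥ p, (hA p).2⟩

variable [IsManifold 𝓘(ℝ, V) ∞ A]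

lemma IsStandardAffineManifold.pullback_coord_pullback_param
    (hA : IsStandardAffineManifold V A) (p : A) {k : ℕ} (α : Form V A k) :
    pullback (hA.coord p) k (pullback (hA.param p) k α) = α :=
  pullback_pullback_eq_self _ _ (fun q => vsub_vadd q p) α

/-- The Poincaré lemma on an affine space. -/
lemma IsStandardAffineManifold.exists_d_eq (hA : IsStandardAffineManifold V A) {k : ℕ}
    (α : Form V A (k + 1)) (hα : d V A (k + 1) α = 0) : ∃ η : Form V A k, d V A k η = α := by
  obtain ⟨p⟩ : Nonempty A := inferInstance
  obtain ⟨η, hη⟩ := exists_d_eq_of_normedSpace (pullback (hA.param p) (k + 1) α)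
    (by rw [d_pullback, hα, map_zero])
  exact ⟨pullback (hA.coord p) k η,
    by rw [d_pullback, hη, hA.pullback_coord_pullback_param]⟩

/-- A closed form of degree `0` on an affine space is constant. -/
lemma IsStandardAffineManifold.exists_eq_constForm (hA : IsStandardAffineManifold V A)
    (α : Form V A 0) (hα : d V A 0 α = 0) : ∃ c : ℂ, α = constForm V A c := by
  obtain ⟨p⟩ : Nonempty A := inferInstance
  set β := pullback (hA.param p) 0 α with hβ
  have hd : d V V 0 β = 0 := by rw [hβ, d_pullback, hα, map_zero]
  have hc := eq_of_extDeriv_eq_zero ((isSmoothForm_self_iff.1 β.2).differentiable (by simp))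
    fun x => (extDerivRaw_self β.1 x).symm.trans (congrFun (congrArg Subtype.val hd) x)
  -- The constant is the value of `β` at the origin on the empty tuple, the second `0`.
  refine ⟨β.1 0 0, ?_⟩
  rw [← hA.pullback_coord_pullback_param p α, ← hβ]
  refine Subtype.ext (funext fun q => ?_)
  ext v
  have h := congrArg (fun g => g 0) (hc (q -ᵥ p) 0)
  refine Eq.trans ?_ h
  exact congrArg (β.1 (q -ᵥ p)) (Subsingleton.elim _ _)

end Affine

/-! ### The connecting isomorphism of the relative de Rham complex. -/

section LongExactSequence

variable {E E' : Type*} [NormedAddCommGroup E] [NormedSpace ℝ E]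
  [NormedAddCommGroup E'] [NormedSpace ℝ E']
  {M N : Type*} [TopologicalSpace M] [ChartedSpace E M] [TopologicalSpace N] [ChartedSpace E' N]
  [IsManifold 𝓘(ℝ, E) ∞ M] [IsManifold 𝓘(ℝ, E') ∞ N] (f : C^∞⟮𝓘(ℝ, E), M; 𝓘(ℝ, E'), N⟯)

lemma HdR.mk_eq_zero_iff {k : ℕ} (G : Form E M (k + 1)) (hG : d E M (k + 1) G = 0) :
    HdR.mk G hG = 0 ↔ ∃ η, d E M k η = G :=
  Submodule.Quotient.mk_eq_zero _

/-- There are no coboundaries in degree `0`, so no exact term `d ξ` appears, in contrast to positive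
degrees. -/
lemma RelHdR.mk_eq_zero_iff_of_zero {w : Form E M 0}
    (hw : relD f 0 (Submodule.Quotient.mk w) = 0) :
    RelHdR.mk f w hw = 0 ↔ ∃ η, pullback f 0 η = w :=
  (Submodule.Quotient.mk_eq_zero _).trans (Submodule.Quotient.mk_eq_zero _)

lemma RelHdR.mk_eq_zero_iff_of_succ {k : ℕ} {w : Form E M (k + 1)}
    (hw : relD f (k + 1) (Submodule.Quotient.mk w) = 0) :
    RelHdR.mk f w hw = 0 ↔ ∃ ξ η, d E M k ξ + pullback f (k + 1) η = w := by
  refine (Submodule.Quotient.mk_eq_zero _).trans ⟨?_, ?_⟩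
  · rintro ⟨x, hx⟩
    obtain ⟨ξ, rfl⟩ := Submodule.Quotient.mk_surjective _ x
    obtain ⟨η, hη⟩ := (Submodule.Quotient.eq (LinearMap.range (pullback f (k + 1)))).1 hx.symm
    exact ⟨ξ, η, by rw [hη]; exact add_sub_cancel _ _⟩
  · rintro ⟨ξ, η, rfl⟩
    refine ⟨Submodule.Quotient.mk ξ, ?_⟩
    exact ((Submodule.Quotient.eq (LinearMap.range (pullback f (k + 1)))).2
      ⟨η, (add_sub_cancel_left _ _).symm⟩).symm

/-- Being a relative cocycle means exactly that `d w` is a pullback; the form `G` found here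
represents the image of the class under the connecting homomorphism. -/
lemma RelHdR.mk_surjective {k : ℕ} (x : RelHdR f k) :
    ∃ w G, ∃ h : d E M k w = pullback f (k + 1) G, x = RelHdR.mk f w (relD_mk_eq_zero f h) := by
  obtain ⟨⟨y, hy⟩, rfl⟩ := Submodule.Quotient.mk_surjective _ x
  obtain ⟨w, rfl⟩ := Submodule.Quotient.mk_surjective _ y
  obtain ⟨G, hG⟩ := (Submodule.Quotient.mk_eq_zero (LinearMap.range (pullback f (k + 1)))).1 hy
  exact ⟨w, G, hG.symm, rfl⟩

/-- If `d w = f^* G` with `G` exact, then the relative class of `w` vanishes, provided that the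
closed forms on `M` are exact up to pullbacks. -/
lemma RelHdR.mk_eq_zero_of_exact
    (hM : ∀ j (α : Form E M (j + 1)), d E M (j + 1) α = 0 → ∃ η, d E M j η = α)
    (hM₀ : ∀ α : Form E M 0, d E M 0 α = 0 → ∃ η, pullback f 0 η = α)
    {k : ℕ} {w : Form E M k} (hw : relD f k (Submodule.Quotient.mk w) = 0) (η : Form E' N k)
    (h : d E M k w = pullback f (k + 1) (d E' N k η)) : RelHdR.mk f w hw = 0 := by
  -- Correcting `w` by a pullback does not change its relative class and makes it closed on `M`.
  have hc : d E M k (w - pullback f k η) = 0 := by rw [map_sub, d_pullback, h, sub_self]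
  cases k with
  | zero =>
    obtain ⟨ζ, hζ⟩ := hM₀ _ hc
    exact (RelHdR.mk_eq_zero_iff_of_zero f hw).2 ⟨ζ + η, by rw [map_add, hζ, sub_add_cancel]⟩
  | succ k =>
    obtain ⟨ξ, hξ⟩ := hM _ _ hc
    exact (RelHdR.mk_eq_zero_iff_of_succ f hw).2 ⟨ξ, η, by rw [hξ, sub_add_cancel]⟩

/-- If `d w = f^* G` and the relative class of `w` vanishes, then `G` is exact. -/
lemma exists_d_eq_of_relHdR_mk_eq_zero (hf : ∀ j, Function.Injective (pullback f j))
    {k : ℕ} {w : Form E M k} (hw : relD f k (Submodule.Quotient.mk w) = 0) {G : Form E' N (k + 1)}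
    (h : d E M k w = pullback f (k + 1) G) (h0 : RelHdR.mk f w hw = 0) :
    ∃ η, d E' N k η = G := by
  cases k with
  | zero =>
    obtain ⟨η, rfl⟩ := (RelHdR.mk_eq_zero_iff_of_zero f hw).1 h0
    exact ⟨η, hf _ (by rw [← d_pullback, h])⟩
  | succ k =>
    obtain ⟨ξ, η, rfl⟩ := (RelHdR.mk_eq_zero_iff_of_succ f hw).1 h0
    exact ⟨η, hf _ (by rw [← d_pullback, ← h, map_add, d_d, zero_add])⟩

/-- The inverse of the connecting homomorphism of `0 → Ω(N) → Ω(M) → Ω(M → N) → 0`, when the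
cohomology of `M` is trivial up to pullbacks. -/
lemma exists_linearEquiv_relHdR
    (hM : ∀ j (α : Form E M (j + 1)), d E M (j + 1) α = 0 → ∃ η, d E M j η = α)
    (hM₀ : ∀ α : Form E M 0, d E M 0 α = 0 → ∃ η, pullback f 0 η = α)
    (hf : ∀ j, Function.Injective (pullback f j)) (k : ℕ) :
    ∃ Φ : HdR E' N (k + 1) ≃ₗ[ℂ] RelHdR f k,
      ∀ (G : Form E' N (k + 1)) (hG : d E' N (k + 1) G = 0)
        (w : Form E M k) (hw : d E M k w = pullback f (k + 1) G),
        Φ (HdR.mk G hG) = RelHdR.mk f w (relD_mk_eq_zero f hw) := by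
  -- A linear choice of primitives, available over a field, makes the map on cocycles linear from
  -- the outset.
  obtain ⟨s, hs⟩ := (d E M k).rangeRestrict.exists_rightInverse_of_surjective
    (LinearMap.range_rangeRestrict _)
  have hs' : ∀ y, d E M k (s y) = y := fun y =>
    congrArg Subtype.val (LinearMap.congr_fun hs y)
  let p : LinearMap.ker (d E' N (k + 1)) →ₗ[ℂ] LinearMap.range (d E M k) :=
    ((pullback f (k + 1)).comp (Submodule.subtype _)).codRestrict _ fun G =>
      hM k _ (by rw [LinearMap.comp_apply, d_pullback, Submodule.subtype_apply, G.2, map_zero])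
  have hsp : ∀ G, d E M k (s (p G)) = pullback f (k + 1) G.1 := fun G => hs' (p G)
  let q : LinearMap.ker (d E' N (k + 1)) →ₗ[ℂ] LinearMap.ker (relD f k) :=
    ((Submodule.mkQ _).comp (s.comp p)).codRestrict _ fun G => relD_mk_eq_zero f (hsp G)
  let Ψ : LinearMap.ker (d E' N (k + 1)) →ₗ[ℂ] RelHdR f k := (Submodule.mkQ _).comp q
  have hΨ : ∀ G, Ψ G = RelHdR.mk f (s (p G)) (relD_mk_eq_zero f (hsp G)) := fun _ => rfl
  have hle : (coboundaries (C := fun k => Form E' N k) (d E' N) (k + 1)).comap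
      (LinearMap.ker (d E' N (k + 1))).subtype ≤ LinearMap.ker Ψ := by
    rintro G ⟨η, hη⟩
    exact RelHdR.mk_eq_zero_of_exact f hM hM₀ _ η ((hsp G).trans (congrArg _ hη.symm))
  let Φ : HdR E' N (k + 1) →ₗ[ℂ] RelHdR f k := Submodule.liftQ _ Ψ hle
  have hΦ : ∀ (G : Form E' N (k + 1)) (hG : d E' N (k + 1) G = 0)
      (w : Form E M k) (hw : d E M k w = pullback f (k + 1) G),
      Φ (HdR.mk G hG) = RelHdR.mk f w (relD_mk_eq_zero f hw) := by
    intro G hG w hw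
    -- Two primitives of the same `f^* G` differ by a closed form, so the vanishing criterion with
    -- `η = 0` shows that the class does not depend on the choice made by `s`.
    have h0 : d E M k (s (p ⟨G, hG⟩) - w) = pullback f (k + 1) (d E' N k 0) := by
      rw [map_sub, hsp, hw, sub_self, map_zero, map_zero]
    exact sub_eq_zero.1 (RelHdR.mk_eq_zero_of_exact f hM hM₀
      (relD_mk_eq_zero f h0) 0 h0)
  refine ⟨LinearEquiv.ofBijective Φ ⟨?_, ?_⟩, hΦ⟩
  · rw [injective_iff_map_eq_zero]
    intro x hx
    obtain ⟨⟨G, hG⟩, rfl⟩ := Submodule.Quotient.mk_surjective _ x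
    exact (HdR.mk_eq_zero_iff G hG).2
      (exists_d_eq_of_relHdR_mk_eq_zero f hf _ (hsp ⟨G, hG⟩) hx)
  · intro x
    obtain ⟨w, G, hw, rfl⟩ := RelHdR.mk_surjective f x
    -- `f^*(d G) = d (d w) = 0`, and injectivity of `f^*` in degree `k + 2` makes `G` closed.
    have hG : d E' N (k + 1) G = 0 := hf _ (by rw [← d_pullback, ← hw, d_d, map_zero])
    exact ⟨HdR.mk G hG, hΦ G hG w hw⟩

end LongExactSequence

end DeRham

theorem lemma2
    {V A : Type*} [NormedAddCommGroup V] [NormedSpace ℝ V] [MetricSpace A] [NormedAddTorsor V A]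
    [ChartedSpace V A] [IsManifold 𝓘(ℝ, V) ∞ A] (hA : DeRham.IsStandardAffineManifold V A)
    {E B : Type*} [NormedAddCommGroup E] [NormedSpace ℝ E] [TopologicalSpace B]
    [ChartedSpace E B] [IsManifold 𝓘(ℝ, E) ∞ B]
    {E' F : Type*} [NormedAddCommGroup E'] [NormedSpace ℝ E'] [TopologicalSpace F]
    [ChartedSpace E' F] [IsManifold 𝓘(ℝ, E') ∞ F]
    (π : C^∞⟮𝓘(ℝ, V), A; 𝓘(ℝ, E), B⟯) (hπ : DeRham.IsSmoothFibreBundle V E E' F π) (k : ℕ) :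
    (∀ G : DeRham.Form E B (k + 1), DeRham.d E B (k + 1) G = 0 →
      ∃ w : DeRham.Form V A k, DeRham.d V A k w = DeRham.pullback π (k + 1) G) ∧
    ∃ Φ : DeRham.HdR E B (k + 1) ≃ₗ[ℂ] DeRham.RelHdR π k,
      ∀ (G : DeRham.Form E B (k + 1)) (hG : DeRham.d E B (k + 1) G = 0)
        (w : DeRham.Form V A k) (hw : DeRham.d V A k w = DeRham.pullback π (k + 1) G),
        Φ (DeRham.HdR.mk G hG) = DeRham.RelHdR.mk π w (DeRham.relD_mk_eq_zero π hw) := by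
  have hM₀ : ∀ α : DeRham.Form V A 0, DeRham.d V A 0 α = 0 → ∃ η, DeRham.pullback π 0 η = α := by
    intro α hα
    obtain ⟨c, rfl⟩ := hA.exists_eq_constForm α hα
    -- Linear maps act trivially on `0`-forms, so pulling back a constant gives the same constant
    -- definitionally.
    exact ⟨DeRham.constForm E B c, rfl⟩
  exact ⟨fun G hG => hA.exists_d_eq _ (by rw [DeRham.d_pullback, hG, map_zero]),
    DeRham.exists_linearEquiv_relHdR π (fun _ => hA.exists_d_eq) hM₀ hπ.pullback_injective k⟩
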